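/- **Setting.** Let $F_X$ be a probability distribution on $\mathbb R^P$ and let $\phi:\mathbb R^P\to[0,1]$ be a fixed measurable function with $\mathbb E\{\phi(X)\}=\int\phi\,dF_X>0$. Consider the missing-data model in which $X\sim F_X$, $Y=\beta(X)+\epsilon$ with $\epsilon\sim\operatorname{Normal}(0,\sigma_y^2)$ independent of $X$, and, given $(X,\epsilon)$, $A\sim\operatorname{Bernoulli}\{\phi(X)\}$ (so that $A$ and $Y$ are conditionally independent given $X$). For a given regression function $\beta$ let $$\Delta=\mathbb E_\beta(Y\mid A=1)-\mathbb E_\beta(Y)$$ be the selection bias. For $g:\mathbb R^P\to\mathbb R$ and $\rho:\mathbb R^P\times\mathbb R^P\to\mathbb R$ write $\bar g=g-\int g\,dF_X$ and $$\bar\rho(x,x')=\rho(x,x')-\int\rho(x,z)\,F_X(dz)-\int\rho(x',z)\,F_X(dz)+\iint\rho(z,z')\,F_X(dz)\,F_X(dz').$$ **Proposition 5.** Let $\beta\sim\operatorname{GP}\{0,\tau_\beta^2\,\rho(\cdot,\cdot)\}$ be a Gaussian process on $\mathbb R^P$ that is jointly measurable in $(x,\omega)$, where $\tau_\beta>0$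 and $\rho$ is a correlation function (a symmetric positive semidefinite kernel with $\rho(x,x)=1$). Then $\Delta$, as a function of the random $\beta$, satisfies $\Delta\sim\operatorname{Normal}(0,c)$ exactly, where $$c=\frac{\tau_\beta^2}{\mathbb E\{\phi(X)\}^2}\iint\bar\phi(x)\,\bar\phi(x')\,\bar\rho(x,x')\,F_X(dx)\,F_X(dx')\ \ge 0 .$$ Moreover $\rho$ has a Karhunen–Loève expansion $\rho(x,x')=\sum_{j=1}^\infty\lambda_j\,v_j(x)\,v_j(x')$ in $\mathscr L_2(F_X)$, that is, $\lambda_j\ge0$, $v_j\in\mathscr L_2(F_X)$, the $v_j$ with $\lambda_j>0$ are orthonormal in $\mathscr L_2(F_X)$ and satisfy $\int\rho(x,z)v_j(z)\,F_X(dz)=\lambda_jv_j(x)$ for $F_X$-almost every $x$, and the series converges to $\rho$ in $\mathscr L_2(F_X\otimes F_X)$ (terms with $\lambda_j=0$ are padding when there are only finitely many positive eigenvalues); and for every such expansion $$c=\frac{\tau_\beta^2}{\mathbb E\{\phi(X)\}^2}\sum_{j=1}^\infty\lambda_j\operatorname{Cov}\{\phi(X),v_j(X)\}^2,$$ with a convergent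 series. -/

import Mathlib

open MeasureTheory ProbabilityTheory Filter Topology
open scoped NNReal ENNReal

noncomputable section

/-- `κ` is a correlation function: a symmetric, positive semidefinite kernel with unit diagonal. -/
structure IsCorrelationFunction {T : Type*} (κ : T → T → ℝ) : Prop where
  symm : ∀ x y, κ x y = κ y x
  diag : ∀ x, κ x x = 1
  nonneg : ∀ (s : Finset T) (a : T → ℝ), 0 ≤ ∑ x ∈ s, ∑ y ∈ s, a x * a y * κ x y

/-- `β ~ GP(m, κ)` under `P`: every finite-dimensional marginal of `β` is (possibly degenerate)
Gaussian, with mean vector `m` and covariance matrix `κ`. -/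
structure IsGP {T Ω : Type*} [MeasurableSpace Ω] (β : T → Ω → ℝ) (m : T → ℝ) (κ : T → T → ℝ)
    (P : Measure Ω) : Prop where
  gaussian : IsGaussianProcess β P
  mean : ∀ x, P[β x] = m x
  cov : ∀ x y, cov[β x, β y; P] = κ x y

/-- The parts of the missing-data model that do not involve the regression function: the covariate
`X` has law `F`, the noise `ε` is `Normal(0, σ2)` and independent of `X`, and, given `(X, ε)`, the
missingness indicator `A` is Bernoulli with success probability `φ(X)`. The outcome with
regression function `b` is `Y = b(X) + ε`. -/
structure IsMissingDataModel {S W : Type*} [MeasurableSpace S] [mW : MeasurableSpace W]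
    (Q : Measure W) (F : Measure S) (φ : S → ℝ) (σ2 : ℝ≥0)
    (X : W → S) (ε : W → ℝ) (A : W → Bool) : Prop where
  measurable_X : Measurable X
  measurable_noise : Measurable ε
  measurable_A : Measurable A
  law_X : Q.map X = F
  law_noise : Q.map ε = gaussianReal 0 σ2
  indep : IndepFun X ε Q
  bernoulli :
    Q[(A ⁻¹' {true}).indicator (fun _ => (1 : ℝ)) |
      MeasurableSpace.comap (fun w => (X w, ε w)) inferInstance] =ᵐ[Q] fun w => φ (X w)

/-- The selection bias `E(Y | A = 1) - E(Y)` where `Y = b(X) + ε`. -/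
def selectionBias {S W : Type*} [MeasurableSpace W] (Q : Measure W)
    (X : W → S) (ε : W → ℝ) (A : W → Bool) (b : S → ℝ) : ℝ :=
  (∫ w, (b (X w) + ε w) ∂(ProbabilityTheory.cond Q (A ⁻¹' {true}))) - ∫ w, (b (X w) + ε w) ∂Q

/-- The centred function `g - ∫ g dF`. -/
def centred {S : Type*} [MeasurableSpace S] (F : Measure S) (g : S → ℝ) (x : S) : ℝ :=
  g x - ∫ z, g z ∂F

/-- The doubly centred kernel
`κ(x, x') - ∫ κ(x, z) F(dz) - ∫ κ(x', z) F(dz) + ∬ κ(z, z') F(dz) F(dz')`. -/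
def centredKernel {S : Type*} [MeasurableSpace S] (F : Measure S) (κ : S → S → ℝ)
    (x x' : S) : ℝ :=
  κ x x' - (∫ z, κ x z ∂F) - (∫ z, κ x' z ∂F) + ∫ z, ∫ z', κ z z' ∂F ∂F

/-- `κ(x, x') = ∑ j, lam j * v j x * v j x'` is a Karhunen–Loève expansion of `κ` in `L²(F)`:
the `v j` are orthonormal eigenfunctions, with eigenvalues `lam j`, of the integral operator on
`L²(F)` with kernel `κ`, and the series converges to `κ` in `L²(F ⊗ F)`. Terms with `lam j = 0`
are only padding (so that kernels of finite rank are covered) and nothing but square-integrability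
is asked of the corresponding `v j`. -/
structure IsKarhunenLoeve {S : Type*} [MeasurableSpace S] (F : Measure S) (κ : S → S → ℝ)
    (lam : ℕ → ℝ) (v : ℕ → S → ℝ) : Prop where
  nonneg : ∀ j, 0 ≤ lam j
  memLp : ∀ j, MemLp (v j) 2 F
  orthonormal : ∀ i j, lam i ≠ 0 → lam j ≠ 0 →
    ∫ x, v i x * v j x ∂F = if i = j then 1 else 0
  eigen : ∀ j, lam j ≠ 0 → ∀ᵐ x ∂F, ∫ z, κ x z * v j z ∂F = lam j * v j x
  expansion : Tendsto
    (fun n : ℕ => eLpNorm (fun p : S × S =>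
      κ p.1 p.2 - ∑ j ∈ Finset.range n, lam j * v j p.1 * v j p.2) 2 (F.prod F))
    atTop (𝓝 0)

/-- The variance
`τ² / E{φ(X)}² * ∬ φbar(x) φbar(x') ρbar(x, x') F(dx) F(dx')`, bars denoting centring. -/
def biasVariance {S : Type*} [MeasurableSpace S] (F : Measure S) (φ : S → ℝ) (ρ : S → S → ℝ)
    (τ : ℝ) : ℝ :=
  τ ^ 2 / (∫ x, φ x ∂F) ^ 2 *
    ∫ x, ∫ x', centred F φ x * centred F φ x' * centredKernel F ρ x x' ∂F ∂F

end

/-! Conditioning on `A = 1` reweights the law of `X` by `φ / E φ`, and the noise contributes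
nothing, so the selection bias is the linear functional `(E φ)⁻¹ ∫ φbar b dF` of the regression
function (`IsMissingDataModel.selectionBias_eq`). It applies to almost every path of `β`, since
almost every path is `F`-integrable.

Such a functional of the process is Gaussian because it lies in the closed span of the `β x` in
`L²(P)`: by Fubini, a `Y` orthogonal to every `β x` is orthogonal to the integral
(`IsGP.hasLaw_integral`). Finite combinations are centred Gaussian, and characteristic functions
carry this to `L²` limits. Fubini also gives the variance as a double integral of the kernel;
centring the kernel does not change it, because `φbar` integrates to zero
(`integral_mul_centredKernel`).

For the expansion, the integral operator of `ρ` is `f ↦ (x ↦ ⟪ρ x, f⟫)`. It is compact as a norm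
limit of finite-rank truncations, it is symmetric, and it is positive because its quadratic form is
a second moment of an integral of `β`. The spectral theorem gives an eigenbasis; expanding each
section `ρ x` in it yields the series, and dominated convergence gives its `L²(F ⊗ F)` limit
(`exists_isKarhunenLoeve`). Pairing any such expansion with `φbar ⊗ φbar` gives the variance as a
series (`IsKarhunenLoeve.hasSum_integral`). -/

section L2Inner

variable {S : Type*} [MeasurableSpace S] {F : Measure S}

lemma inner_Lp_two_eq_integral (f g : Lp ℝ 2 F) : inner ℝ f g = ∫ x, f x * g x ∂F := by
  rw [L2.inner_def]
  exact integral_congr_ae (Eventually.of_forall fun x => by simp [mul_comm])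

lemma inner_toLp_toLp {f g : S → ℝ} (hf : MemLp f 2 F) (hg : MemLp g 2 F) :
    inner ℝ (hf.toLp f) (hg.toLp g) = ∫ x, f x * g x ∂F := by
  rw [inner_Lp_two_eq_integral]
  refine integral_congr_ae ?_
  filter_upwards [hf.coeFn_toLp, hg.coeFn_toLp] with x h1 h2
  rw [h1, h2]

lemma norm_sq_toLp {f : S → ℝ} (hf : MemLp f 2 F) : ‖hf.toLp f‖ ^ 2 = ∫ x, f x ^ 2 ∂F := by
  rw [← real_inner_self_eq_norm_sq, inner_toLp_toLp]
  simp only [sq]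

lemma norm_sq_Lp_two_eq_integral (f : Lp ℝ 2 F) : ‖f‖ ^ 2 = ∫ x, f x ^ 2 ∂F := by
  rw [← real_inner_self_eq_norm_sq, inner_Lp_two_eq_integral]
  simp only [sq]

end L2Inner

/-! ### Gaussian laws on the closed `L²` span of a Gaussian process. -/

section GaussianLimits

variable {Ω : Type*} [MeasurableSpace Ω] {P : Measure Ω} [IsProbabilityMeasure P]

/-- In `L²`, a limit of centred Gaussian variables is a centred Gaussian variable. -/
lemma map_eq_gaussianReal_of_mem_closure {K : Set (Lp ℝ 2 P)}
    (hK : ∀ Z ∈ K, P.map Z = gaussianReal 0 (‖Z‖ ^ 2).toNNReal) {Z : Lp ℝ 2 P}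
    (hZ : Z ∈ closure K) : P.map Z = gaussianReal 0 (‖Z‖ ^ 2).toNNReal := by
  obtain ⟨u, huK, hu⟩ := mem_closure_iff_seq_limit.1 hZ
  have hmeas : ∀ Y : Lp ℝ 2 P, AEMeasurable Y P := fun Y =>
    (Lp.aestronglyMeasurable Y).aemeasurable
  -- `L²` convergence gives convergence in law, while the variances `‖u n‖ ^ 2` converge to `‖Z‖ ^
  -- 2`; the limiting characteristic function is therefore known.
  have hdist := (tendstoInMeasure_of_tendsto_Lp hu).tendstoInDistribution fun n => hmeas (u n)
  have : IsProbabilityMeasure (P.map Z) := Measure.isProbabilityMeasure_map (hmeas Z)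
  refine Measure.ext_of_charFun (funext fun t => ?_)
  have h1 := ProbabilityMeasure.tendsto_iff_tendsto_charFun.1 hdist.tendsto t
  refine tendsto_nhds_unique h1 ?_
  simp only [ProbabilityMeasure.coe_mk, charFun_gaussianReal]
  have h2 : Tendsto (fun n => ‖u n‖ ^ 2) atTop (𝓝 (‖Z‖ ^ 2)) := (hu.norm).pow 2
  have h3 : ∀ n, charFun (P.map (u n)) t
      = Complex.exp (t * (0 : ℝ) * Complex.I - ((‖u n‖ ^ 2 : ℝ) : ℂ) * t ^ 2 / 2) := fun n => by
    rw [hK _ (huK n), charFun_gaussianReal, Real.coe_toNNReal _ (by positivity)]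
  simp only [h3]
  rw [Real.coe_toNNReal _ (by positivity)]
  refine (Complex.continuous_exp.tendsto _).comp (tendsto_const_nhds.sub ?_)
  exact (((Complex.continuous_ofReal.tendsto _).comp h2).mul_const _).div_const _

variable {T : Type*} {β : T → Ω → ℝ}

lemma map_eq_gaussianReal_of_mem_span (hβ : IsGaussianProcess β P) (hmean : ∀ x, P[β x] = 0)
    (hL : ∀ x, MemLp (β x) 2 P) {Z : Lp ℝ 2 P}
    (hZ : Z ∈ Submodule.span ℝ (Set.range fun x => (hL x).toLp (β x))) :
    P.map Z = gaussianReal 0 (‖Z‖ ^ 2).toNNReal := by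
  obtain ⟨c, rfl⟩ := Finsupp.mem_span_range_iff_exists_finsupp.1 hZ
  set Z := c.sum fun i a => a • (hL i).toLp (β i) with hZdef
  have hae : (Z : Ω → ℝ) =ᵐ[P] fun ω => ∑ x ∈ c.support, c x • β x ω := by
    rw [hZdef, Finsupp.sum]
    refine (Lp.coeFn_fun_finsetSum _ _).trans ?_
    have : ∀ x ∈ c.support, ∀ᵐ ω ∂P, (c x • (hL x).toLp (β x) : Lp ℝ 2 P) ω = c x • β x ω := by
      intro x _
      filter_upwards [Lp.coeFn_smul (c x) ((hL x).toLp (β x)), (hL x).coeFn_toLp] with ω h1 h2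
      rw [h1, Pi.smul_apply, h2]
    filter_upwards [(Finset.eventually_all c.support).2 this] with ω h
    exact Finset.sum_congr rfl h
  have hG := (hβ.smul c).hasGaussianLaw_fun_sum (I := c.support)
  have hG' : HasGaussianLaw Z P := hG.congr hae.symm
  have hm : P[(Z : Ω → ℝ)] = 0 := by
    rw [integral_congr_ae hae, integral_finsetSum (f := fun x ω => c x • β x ω) _ fun x _ =>
      ((hL x).integrable one_le_two).smul (c x)]
    exact Finset.sum_eq_zero fun x _ => by rw [integral_smul, hmean, smul_zero]
  rw [hG'.map_eq_gaussianReal, hm, variance_of_integral_eq_zero hG'.aemeasurable hm,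
    norm_sq_Lp_two_eq_integral]

end GaussianLimits

/-! ### Integrals of a jointly measurable Gaussian process. -/

section IntegratedProcess

lemma IsGP.memLp_two {T Ω : Type*} [MeasurableSpace Ω] {P : Measure Ω} {β : T → Ω → ℝ}
    {m : T → ℝ} {κ : T → T → ℝ} (hβ : IsGP β m κ P) (x : T) : MemLp (β x) 2 P :=
  (hβ.gaussian.hasGaussianLaw_eval x).memLp_two

lemma IsGP.integral_mul {T Ω : Type*} [MeasurableSpace Ω] {P : Measure Ω}
    [IsProbabilityMeasure P] {β : T → Ω → ℝ} {κ : T → T → ℝ}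
    (hβ : IsGP β (fun _ => 0) κ P) (x y : T) :
    ∫ ω, β x ω * β y ω ∂P = κ x y := by
  rw [← hβ.cov x y, covariance_eq_sub (hβ.memLp_two x) (hβ.memLp_two y), hβ.mean x]
  simp

lemma integral_norm_mul_le {Ω : Type*} [MeasurableSpace Ω] {P : Measure Ω} {f g : Ω → ℝ}
    (hf : MemLp f 2 P) (hg : MemLp g 2 P) :
    ∫ ω, ‖f ω * g ω‖ ∂P ≤ (∫ ω, f ω ^ 2 ∂P + ∫ ω, g ω ^ 2 ∂P) / 2 := by
  rw [← integral_add hf.integrable_sq hg.integrable_sq, ← integral_div]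
  refine integral_mono (hf.integrable_mul hg).norm
    ((hf.integrable_sq.add hg.integrable_sq).div_const 2) fun ω => ?_
  simp only [Real.norm_eq_abs, abs_mul]
  nlinarith [sq_nonneg (|f ω| - |g ω|), sq_abs (f ω), sq_abs (g ω)]

variable {S Ω : Type*} [MeasurableSpace S] [MeasurableSpace Ω] {F : Measure S} {P : Measure Ω}
  [SFinite F] [IsProbabilityMeasure P] {β : S → Ω → ℝ} {κ : S → S → ℝ} {C : ℝ}

/-- The kernel is the parametrised integral `E (β x * β y)`, so it inherits measurability from the
process. -/
lemma IsGP.measurable_kernel (hβ : IsGP β (fun _ => 0) κ P)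
    (hmeas : Measurable fun p : S × Ω => β p.1 p.2) :
    Measurable fun p : S × S => κ p.1 p.2 := by
  simp_rw [← hβ.integral_mul]
  have h : Measurable fun q : (S × S) × Ω => β q.1.1 q.2 * β q.1.2 q.2 :=
    (hmeas.comp (measurable_fst.fst.prodMk measurable_snd)).mul
      (hmeas.comp (measurable_fst.snd.prodMk measurable_snd))
  exact h.stronglyMeasurable.integral_prod_right.measurable

/-- Licence for Fubini: `E |β x * Y|` is at most `(C + E Y²) / 2`, uniformly in `x`, so
integrability of `h` suffices. -/
lemma IsGP.integrable_mul_mul (hβ : IsGP β (fun _ => 0) κ P)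
    (hmeas : Measurable fun p : S × Ω => β p.1 p.2) (hC : ∀ x, κ x x ≤ C)
    {F : Measure S} {h : S → ℝ} (hh : Integrable h F) {Y : Ω → ℝ} (hY : MemLp Y 2 P) :
    Integrable (fun p : S × Ω => h p.1 * β p.1 p.2 * Y p.2) (F.prod P) := by
  have hm : AEStronglyMeasurable (fun p : S × Ω => h p.1 * β p.1 p.2 * Y p.2) (F.prod P) :=
    (hh.aestronglyMeasurable.comp_fst.mul hmeas.aestronglyMeasurable).mul
      hY.aestronglyMeasurable.comp_snd
  refine (integrable_prod_iff hm).2 ⟨Eventually.of_forall fun x => ?_, ?_⟩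
  · simp only [mul_assoc]
    exact ((hβ.memLp_two x).integrable_mul hY).const_mul (h x)
  · refine (hh.norm.mul_const ((C + ∫ ω, Y ω ^ 2 ∂P) / 2)).mono' hm.norm.integral_prod_right'
      (Eventually.of_forall fun x => ?_)
    have h1 : ∫ ω, ‖h x * β x ω * Y ω‖ ∂P = ‖h x‖ * ∫ ω, ‖β x ω * Y ω‖ ∂P := by
      rw [← integral_const_mul]
      simp [mul_assoc]
    rw [Real.norm_of_nonneg (integral_nonneg fun _ => norm_nonneg _)]
    simp only [h1]
    refine mul_le_mul_of_nonneg_left ((integral_norm_mul_le (hβ.memLp_two x) hY).trans ?_)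
      (norm_nonneg _)
    have h2 := hβ.integral_mul x x
    simp only [← sq] at h2
    linarith [hC x]

lemma IsGP.integrable_mul_mul_prod (hβ : IsGP β (fun _ => 0) κ P)
    (hmeas : Measurable fun p : S × Ω => β p.1 p.2) (hC : ∀ x, κ x x ≤ C)
    {F : Measure S} {h : S → ℝ} (hh : Integrable h F) :
    Integrable (fun q : (S × S) × Ω => h q.1.1 * h q.1.2 * (β q.1.1 q.2 * β q.1.2 q.2))
      ((F.prod F).prod P) := by
  have hhh : Integrable (fun p : S × S => h p.1 * h p.2) (F.prod F) := hh.mul_prod hh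
  have hβm : Measurable fun q : (S × S) × Ω => β q.1.1 q.2 * β q.1.2 q.2 :=
    (hmeas.comp (measurable_fst.fst.prodMk measurable_snd)).mul
      (hmeas.comp (measurable_fst.snd.prodMk measurable_snd))
  have hm : AEStronglyMeasurable
      (fun q : (S × S) × Ω => h q.1.1 * h q.1.2 * (β q.1.1 q.2 * β q.1.2 q.2))
      ((F.prod F).prod P) :=
    hhh.aestronglyMeasurable.comp_fst.mul hβm.aestronglyMeasurable
  refine (integrable_prod_iff hm).2 ⟨Eventually.of_forall fun p => ?_, ?_⟩
  · exact ((hβ.memLp_two p.1).integrable_mul (hβ.memLp_two p.2)).const_mul (h p.1 * h p.2)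
  · refine (hhh.norm.mul_const C).mono' hm.norm.integral_prod_right'
      (Eventually.of_forall fun p => ?_)
    have h1 : ∫ ω, ‖h p.1 * h p.2 * (β p.1 ω * β p.2 ω)‖ ∂P
        = ‖h p.1 * h p.2‖ * ∫ ω, ‖β p.1 ω * β p.2 ω‖ ∂P := by
      rw [← integral_const_mul]
      simp only [norm_mul]
    rw [Real.norm_of_nonneg (integral_nonneg fun _ => norm_nonneg _)]
    simp only [h1]
    refine mul_le_mul_of_nonneg_left
      ((integral_norm_mul_le (hβ.memLp_two p.1) (hβ.memLp_two p.2)).trans ?_) (norm_nonneg _)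
    have h2 := hβ.integral_mul p.1 p.1
    have h3 := hβ.integral_mul p.2 p.2
    simp only [← sq] at h2 h3
    linarith [hC p.1, hC p.2]

/-- Turning the square into a double integral allows the expectation over `P` to be taken inside. -/
lemma sq_integral_eq_integral_prod (h : S → ℝ) (b : S → ℝ) :
    (∫ x, h x * b x ∂F) ^ 2 = ∫ p : S × S, h p.1 * h p.2 * (b p.1 * b p.2) ∂(F.prod F) := by
  rw [sq, ← integral_prod_mul]
  exact integral_congr_ae (Eventually.of_forall fun p => by ring)

lemma IsGP.integral_sq_integral (hβ : IsGP β (fun _ => 0) κ P)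
    (hmeas : Measurable fun p : S × Ω => β p.1 p.2) (hC : ∀ x, κ x x ≤ C)
    {h : S → ℝ} (hh : Integrable h F) :
    ∫ ω, (∫ x, h x * β x ω ∂F) ^ 2 ∂P
      = ∫ p : S × S, h p.1 * h p.2 * κ p.1 p.2 ∂(F.prod F) := by
  simp only [sq_integral_eq_integral_prod h fun x => β x _]
  rw [← integral_integral_swap (f := fun (p : S × S) (ω : Ω) =>
    h p.1 * h p.2 * (β p.1 ω * β p.2 ω)) (hβ.integrable_mul_mul_prod hmeas hC hh)]
  simp only [integral_const_mul, hβ.integral_mul]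

lemma IsGP.memLp_two_integral (hβ : IsGP β (fun _ => 0) κ P)
    (hmeas : Measurable fun p : S × Ω => β p.1 p.2) (hC : ∀ x, κ x x ≤ C)
    {h : S → ℝ} (hh : Integrable h F) :
    MemLp (fun ω => ∫ x, h x * β x ω ∂F) 2 P := by
  have h1 := hβ.integrable_mul_mul hmeas hC hh (memLp_const (1 : ℝ))
  simp only [mul_one] at h1
  refine (memLp_two_iff_integrable_sq h1.integral_prod_right.aestronglyMeasurable).2 ?_
  simp only [sq_integral_eq_integral_prod h fun x => β x _]
  exact (hβ.integrable_mul_mul_prod hmeas hC hh).integral_prod_right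

/-- Integrating a jointly measurable centred Gaussian process against an integrable weight gives a
centred Gaussian variable. -/
theorem IsGP.hasLaw_integral (hβ : IsGP β (fun _ => 0) κ P)
    (hmeas : Measurable fun p : S × Ω => β p.1 p.2) (hC : ∀ x, κ x x ≤ C)
    {h : S → ℝ} (hh : Integrable h F) :
    HasLaw (fun ω => ∫ x, h x * β x ω ∂F)
      (gaussianReal 0 (∫ p : S × S, h p.1 * h p.2 * κ p.1 p.2 ∂(F.prod F)).toNNReal) P := by
  have hZ := hβ.memLp_two_integral hmeas hC hh
  refine ⟨hZ.aestronglyMeasurable.aemeasurable, ?_⟩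
  set K := Submodule.span ℝ (Set.range fun x => (hβ.memLp_two x).toLp (β x)) with hK
  -- The closure is the double orthogonal complement, so no approximation of the integral by sums is
  -- needed.
  have hmem : hZ.toLp _ ∈ K.topologicalClosure := by
    rw [← Submodule.orthogonal_orthogonal_eq_closure, Submodule.mem_orthogonal]
    intro Y hY
    have hY0 : ∀ x, ∫ ω, β x ω * Y ω ∂P = 0 := fun x => by
      have := (Submodule.mem_orthogonal _ _).1 hY _ (Submodule.subset_span ⟨x, rfl⟩)
      rw [← this, inner_Lp_two_eq_integral]
      refine integral_congr_ae ?_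
      filter_upwards [(hβ.memLp_two x).coeFn_toLp] with ω h1
      rw [h1]
    have hint := hβ.integrable_mul_mul hmeas hC hh (Lp.memLp Y)
    calc inner ℝ Y (hZ.toLp _) = ∫ ω, Y ω * ∫ x, h x * β x ω ∂F ∂P := by
          rw [inner_Lp_two_eq_integral]
          refine integral_congr_ae ?_
          filter_upwards [hZ.coeFn_toLp] with ω h1
          rw [h1]
      _ = ∫ ω, ∫ x, h x * β x ω * Y ω ∂F ∂P := by
          simp only [integral_mul_const, mul_comm]
      _ = ∫ x, ∫ ω, h x * β x ω * Y ω ∂P ∂F := (integral_integral_swap hint).symm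
      _ = 0 := by simp only [mul_assoc, integral_const_mul, hY0, mul_zero, integral_zero]
  have := map_eq_gaussianReal_of_mem_closure (K := (K : Set (Lp ℝ 2 P)))
    (fun Z hZ => map_eq_gaussianReal_of_mem_span hβ.gaussian hβ.mean hβ.memLp_two hZ) hmem
  rwa [norm_sq_toLp, hβ.integral_sq_integral hmeas hC hh, Measure.map_congr hZ.coeFn_toLp] at this

end IntegratedProcess

/-! ### The selection bias as a linear functional of the regression function. -/

section SelectionBias

variable {S W : Type*} [MeasurableSpace S] [MeasurableSpace W] {Q : Measure W}
  [IsProbabilityMeasure Q] {F : Measure S} {φ : S → ℝ} {σ2 : ℝ≥0} {X : W → S} {ε : W → ℝ}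
  {A : W → Bool}

/-- Integrals of functions of `(X, ε)` over the event `A = 1` are integrals weighted by `φ(X)`. -/
lemma IsMissingDataModel.setIntegral_eq (hmodel : IsMissingDataModel Q F φ σ2 X ε A)
    {g : S × ℝ → ℝ} (hg : Measurable g) (hgi : Integrable (fun w => g (X w, ε w)) Q) :
    ∫ w in A ⁻¹' {true}, g (X w, ε w) ∂Q = ∫ w, φ (X w) * g (X w, ε w) ∂Q := by
  have hA : MeasurableSet (A ⁻¹' {true}) := hmodel.measurable_A (measurableSet_singleton _)
  have hXε : Measurable fun w => (X w, ε w) := hmodel.measurable_X.prodMk hmodel.measurable_noise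
  have hle := hXε.comap_le
  have hgm : StronglyMeasurable[MeasurableSpace.comap (fun w => (X w, ε w)) inferInstance]
      fun w => g (X w, ε w) :=
    (hg.comp (comap_measurable fun w => (X w, ε w))).stronglyMeasurable
  have hind : Integrable ((A ⁻¹' {true}).indicator fun _ => (1 : ℝ)) Q :=
    (integrable_const 1).indicator hA
  have heq : ((A ⁻¹' {true}).indicator fun _ => (1 : ℝ)) * (fun w => g (X w, ε w))
      = (A ⁻¹' {true}).indicator fun w => g (X w, ε w) := by
    ext w
    by_cases hw : w ∈ A ⁻¹' {true} <;> simp [Set.indicator, hw]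
  have hprod : Integrable (((A ⁻¹' {true}).indicator fun _ => (1 : ℝ)) *
      fun w => g (X w, ε w)) Q := by
    rw [heq]
    exact hgi.indicator hA
  -- `g (X, ε)` is measurable for the conditioning σ-algebra and pulls out, leaving the conditional
  -- probability of `A = 1`, which is `φ(X)`.
  have hpull := condExp_mul_of_stronglyMeasurable_right hgm hprod hind
  rw [← integral_indicator hA, ← heq, ← integral_condExp hle]
  refine integral_congr_ae ?_
  filter_upwards [hpull, hmodel.bernoulli] with w h1 h2
  rw [h1, Pi.mul_apply, h2]

lemma IsMissingDataModel.selectionBias_eq (hmodel : IsMissingDataModel Q F φ σ2 X ε A)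
    [IsProbabilityMeasure F] (hφ : Measurable φ) (hφ01 : ∀ x, φ x ∈ Set.Icc (0 : ℝ) 1)
    (hφpos : 0 < ∫ x, φ x ∂F) {b : S → ℝ} (hb : Measurable b) (hbi : Integrable b F) :
    selectionBias Q X ε A b = (∫ x, φ x ∂F)⁻¹ * ∫ x, centred F φ x * b x ∂F := by
  have hX := hmodel.measurable_X
  have hφX : ∀ {g : S → ℝ}, Measurable g → ∫ w, g (X w) ∂Q = ∫ x, g x ∂F := fun {g} hg => by
    rw [← hmodel.law_X, integral_map hX.aemeasurable hg.aestronglyMeasurable]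
  have hbX : Integrable (fun w => b (X w)) Q := by
    have := hbi
    rw [← hmodel.law_X] at this
    exact this.comp_measurable hX
  have hφle : ∀ x, ‖φ x‖ ≤ 1 := fun x => by
    rw [Real.norm_of_nonneg (hφ01 x).1]
    exact (hφ01 x).2
  have hεi : Integrable ε Q := by
    have h1 : Integrable (fun x : ℝ => x) (gaussianReal 0 σ2) :=
      (memLp_id_gaussianReal 1).integrable le_rfl
    rw [← hmodel.law_noise] at h1
    exact h1.comp_measurable hmodel.measurable_noise
  have hε0 : ∫ w, ε w ∂Q = 0 := by
    have := integral_map hmodel.measurable_noise.aemeasurable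
      (f := fun x : ℝ => x) (μ := Q) (by fun_prop)
    rw [← this, hmodel.law_noise, integral_id_gaussianReal]
  have hφint : ∫ w in A ⁻¹' {true}, (1 : ℝ) ∂Q = ∫ x, φ x ∂F := by
    rw [hmodel.setIntegral_eq (g := fun _ => 1) measurable_const (integrable_const 1)]
    simp only [mul_one]
    exact hφX hφ
  have hφb : Integrable (fun x => φ x * b x) F :=
    hbi.bdd_mul hφ.aestronglyMeasurable (Eventually.of_forall hφle)
  -- Independence of `X` and `ε` removes the noise from the conditional mean as well.
  have hφε : ∫ w, φ (X w) * ε w ∂Q = 0 := by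
    rw [hmodel.indep.integral_fun_comp_mul_comp (f := φ) (g := fun x => x) hX.aemeasurable
      hmodel.measurable_noise.aemeasurable hφ.aestronglyMeasurable (by fun_prop), hε0, mul_zero]
  have hnum : ∫ w in A ⁻¹' {true}, (b (X w) + ε w) ∂Q = ∫ x, φ x * b x ∂F := by
    rw [hmodel.setIntegral_eq (g := fun p => b p.1 + p.2)
      ((hb.comp measurable_fst).add measurable_snd) (hbX.add hεi)]
    simp only [mul_add]
    have hφXm : AEStronglyMeasurable (fun w => φ (X w)) Q :=
      (hφ.comp hX).aestronglyMeasurable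
    rw [integral_add (hbX.bdd_mul hφXm (Eventually.of_forall fun w => hφle _))
      (hεi.bdd_mul hφXm (Eventually.of_forall fun w => hφle _)), hφε, add_zero]
    exact hφX (hφ.mul hb)
  have hQA : (Q (A ⁻¹' {true})).toReal = ∫ x, φ x ∂F := by
    rw [← hφint]
    simp [Measure.real]
  rw [selectionBias, ProbabilityTheory.cond, integral_smul_measure, ENNReal.toReal_inv, hQA, hnum,
    integral_add hbX hεi, hε0, add_zero, hφX hb]
  simp only [centred, sub_mul]
  rw [integral_sub hφb (hbi.const_mul _), integral_const_mul, smul_eq_mul]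
  field_simp

end SelectionBias

/-! ### Hilbert bases indexed by `ℕ`, padded with zeros. -/

section PaddedBasis

variable {H : Type*} [NormedAddCommGroup H] [InnerProductSpace ℝ H]

/-- A sequence that, once its zero terms are removed, is a Hilbert basis. -/
structure IsPaddedHilbertBasis (e : ℕ → H) : Prop where
  inner_eq_zero : ∀ i j, i ≠ j → inner ℝ (e i) (e j) = 0
  eq_zero_or_norm : ∀ i, e i = 0 ∨ ‖e i‖ = 1
  hasSum : ∀ x, HasSum (fun i => inner ℝ (e i) x • e i) x

/-- Distinct basis vectors are `√2` apart, so the balls of radius `1/2` around them are disjoint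
open sets in a separable space. -/
lemma HilbertBasis.countable_index [TopologicalSpace.SeparableSpace H] {ι : Type*}
    (b : HilbertBasis ι ℝ H) : Countable ι := by
  refine Pairwise.countable_of_isOpen_disjoint (s := fun i => Metric.ball (b i) (1 / 2)) ?_
    (fun i => Metric.isOpen_ball) fun i => Metric.nonempty_ball.2 (by norm_num)
  intro i j hij
  refine Metric.ball_disjoint_ball ?_
  have h1 : ‖b i - b j‖ ^ 2 = 2 := by
    rw [norm_sub_sq_real, b.orthonormal.2 hij, b.orthonormal.1, b.orthonormal.1]
    norm_num
  rw [dist_eq_norm]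
  nlinarith [norm_nonneg (b i - b j)]

lemma HilbertBasis.isPaddedHilbertBasis_extend {ι : Type*} (b : HilbertBasis ι ℝ H)
    {f : ι → ℕ} (hf : f.Injective) : IsPaddedHilbertBasis (Function.extend f b 0) := by
  have h0 : ∀ n, n ∉ Set.range f → Function.extend f b 0 n = 0 := fun n hn =>
    Function.extend_apply' _ _ _ fun ⟨i, hi⟩ => hn ⟨i, hi⟩
  refine ⟨fun m n hmn => ?_, fun n => ?_, fun x => ?_⟩
  · by_cases hm : m ∈ Set.range f
    · by_cases hn : n ∈ Set.range f
      · obtain ⟨i, rfl⟩ := hm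
        obtain ⟨j, rfl⟩ := hn
        rw [hf.extend_apply, hf.extend_apply]
        exact b.orthonormal.2 fun hij => hmn (by rw [hij])
      · rw [h0 n hn, inner_zero_right]
    · rw [h0 m hm, inner_zero_left]
  · by_cases hn : n ∈ Set.range f
    · obtain ⟨i, rfl⟩ := hn
      rw [hf.extend_apply]
      exact Or.inr (b.orthonormal.1 i)
    · exact Or.inl (h0 n hn)
  · refine (hf.hasSum_iff fun n hn => ?_).1 ?_
    · rw [h0 n hn, smul_zero]
    · have := b.hasSum_repr x
      simp only [b.repr_apply_apply] at this
      simpa only [Function.comp_def, hf.extend_apply] using this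

lemma exists_isPaddedHilbertBasis [CompleteSpace H] [TopologicalSpace.SeparableSpace H] :
    ∃ e : ℕ → H, IsPaddedHilbertBasis e := by
  obtain ⟨w, b, -⟩ := exists_hilbertBasis ℝ H
  have := b.countable_index
  obtain ⟨f, hf⟩ := exists_injective_nat w
  exact ⟨_, b.isPaddedHilbertBasis_extend hf⟩

namespace IsPaddedHilbertBasis

/-- The part of `x` not captured by the first `n` terms of the sequence `e`. -/
noncomputable def remainder (e : ℕ → H) (n : ℕ) (x : H) : H :=
  x - ∑ i ∈ Finset.range n, inner ℝ (e i) x • e i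

variable {e : ℕ → H}

lemma tendsto_remainder (he : IsPaddedHilbertBasis e) (x : H) :
    Tendsto (fun n => remainder e n x) atTop (𝓝 0) := by
  have := (tendsto_const_nhds (x := x)).sub (he.hasSum x).tendsto_sum_nat
  rwa [sub_self] at this

/-- Each `x ↦ ⟪e i, x⟫ e i` is symmetric, whatever the `e i`. This later moves the truncation from
the argument of an operator onto its kernel. -/
lemma inner_remainder_comm (n : ℕ) (x y : H) :
    inner ℝ (remainder e n x) y = inner ℝ x (remainder e n y) := by
  simp only [remainder, inner_sub_left, inner_sub_right, sum_inner, inner_sum, inner_smul_left,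
    inner_smul_right, RCLike.conj_to_real]
  congr 1
  refine Finset.sum_congr rfl fun i _ => ?_
  rw [real_inner_comm (e i) x]
  ring

lemma norm_remainder_le (he : IsPaddedHilbertBasis e) (n : ℕ) (x : H) :
    ‖remainder e n x‖ ≤ ‖x‖ := by
  induction n with
  | zero => simp [remainder]
  | succ n ih =>
    refine le_trans ?_ ih
    have h1 : remainder e (n + 1) x = remainder e n x - inner ℝ (e n) x • e n := by
      simp only [remainder, Finset.sum_range_succ]
      abel
    -- The first `n` terms are orthogonal to `e n`, so passing to `n + 1` subtracts the projection
    -- onto `e n`, which cannot increase the norm.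
    have h2 : inner ℝ (remainder e n x) (e n) = inner ℝ (e n) x := by
      rw [inner_remainder_comm, remainder, Finset.sum_eq_zero, sub_zero, real_inner_comm]
      intro i hi
      rw [he.inner_eq_zero i n (Finset.mem_range.1 hi).ne, zero_smul]
    rcases he.eq_zero_or_norm n with h0 | h0
    · rw [h1, h0, smul_zero, sub_zero]
    · refine abs_le_of_sq_le_sq' ?_ (norm_nonneg _) |>.2
      rw [h1, norm_sub_sq_real, inner_smul_right, h2, norm_smul, h0, mul_one, Real.norm_eq_abs,
        sq_abs]
      nlinarith [sq_nonneg (inner ℝ (e n) x : ℝ)]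

end IsPaddedHilbertBasis

end PaddedBasis

/-! ### Eigenbases of compact self-adjoint operators. -/

section Diagonalization

universe u

variable {H : Type u} [NormedAddCommGroup H] [InnerProductSpace ℝ H] [CompleteSpace H]

/-- Hilbert bases of the summands are glued together: a vector orthogonal to all of them is
orthogonal to every `V k`, hence zero. -/
lemma OrthogonalFamily.exists_hilbertBasis {κ : Type} {V : κ → Submodule ℝ H}
    [∀ k, CompleteSpace (V k)] (hV : OrthogonalFamily ℝ (fun k => V k) fun k => (V k).subtypeₗᵢ)
    (hbot : (⨆ k, V k)ᗮ = ⊥) :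
    ∃ (ι : Type u) (b : HilbertBasis ι ℝ H) (k : ι → κ), ∀ i, b i ∈ V (k i) := by
  choose w b hb using fun k => _root_.exists_hilbertBasis ℝ (V k)
  have horth := hV.orthonormal_sigma_orthonormal fun k => (b k).orthonormal
  have hspan : (Submodule.span ℝ (Set.range fun a : Σ k, w k =>
      (V a.1).subtypeₗᵢ (b a.1 a.2)))ᗮ = ⊥ := by
    rw [eq_bot_iff, ← hbot]
    intro x hx
    rw [← Submodule.iInf_orthogonal, Submodule.mem_iInf]
    intro k
    rw [Submodule.mem_orthogonal]
    intro y hy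
    have hs := (((b k).hasSum_repr ⟨y, hy⟩).mapL (V k).subtypeL).mapL (innerSL ℝ x)
    have hzero : ∀ i, inner ℝ x (b k i : H) = 0 := fun i =>
      (Submodule.mem_orthogonal' _ _).1 hx _ (Submodule.subset_span ⟨⟨k, i⟩, rfl⟩)
    simp only [map_smul, Submodule.subtypeL_apply, innerSL_apply_apply, hzero, smul_zero] at hs
    rw [real_inner_comm]
    exact hs.unique hasSum_zero
  refine ⟨_, HilbertBasis.mkOfOrthogonalEqBot horth hspan, fun a => a.1, fun a => ?_⟩
  rw [HilbertBasis.coe_mkOfOrthogonalEqBot]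
  exact (b a.1 a.2).2

/-- A compact self-adjoint operator has a Hilbert basis of eigenvectors. -/
lemma exists_hilbertBasis_eigenvectors {T : H →L[ℝ] H} (hT : IsCompactOperator T)
    (hsymm : (T : H →ₗ[ℝ] H).IsSymmetric) :
    ∃ (ι : Type u) (b : HilbertBasis ι ℝ H) (μ : ι → ℝ), ∀ i, T (b i) = μ i • b i := by
  have hcomplete : ∀ μ : ℝ, CompleteSpace (Module.End.eigenspace (T : H →ₗ[ℝ] H) μ) := by
    intro μ
    have : (Module.End.eigenspace (T : H →ₗ[ℝ] H) μ : Set H) = {x | T x = μ • x} := by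
      ext x
      exact Module.End.mem_eigenspace_iff
    have hclosed : IsClosed (Module.End.eigenspace (T : H →ₗ[ℝ] H) μ : Set H) := by
      rw [this]
      exact isClosed_eq T.continuous (continuous_const_smul μ)
    exact hclosed.completeSpace_coe
  obtain ⟨ι, b, μ, hb⟩ := hsymm.orthogonalFamily_eigenspaces.exists_hilbertBasis
    (ContinuousLinearMap.orthogonalComplement_iSup_eigenspaces_eq_bot hT hsymm)
  exact ⟨ι, b, μ, fun i => Module.End.mem_eigenspace_iff.1 (hb i)⟩

/-- Any scalar is an eigenvalue for a padding vector; the last clause fixes it to be zero, so that a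
nonzero `lam n` forces `e n` to be a unit vector. -/
lemma exists_isPaddedHilbertBasis_eigenvectors [TopologicalSpace.SeparableSpace H] {T : H →L[ℝ] H}
    (hT : IsCompactOperator T) (hsymm : (T : H →ₗ[ℝ] H).IsSymmetric) :
    ∃ (e : ℕ → H) (lam : ℕ → ℝ), IsPaddedHilbertBasis e ∧ (∀ n, T (e n) = lam n • e n) ∧
      ∀ n, e n = 0 → lam n = 0 := by
  obtain ⟨ι, b, μ, hb⟩ := exists_hilbertBasis_eigenvectors hT hsymm
  have := b.countable_index
  obtain ⟨f, hf⟩ := exists_injective_nat ι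
  refine ⟨_, Function.extend f μ 0, b.isPaddedHilbertBasis_extend hf, fun n => ?_, fun n => ?_⟩
  · by_cases hn : ∃ i, f i = n
    · obtain ⟨i, rfl⟩ := hn
      rw [hf.extend_apply, hf.extend_apply, hb]
    · rw [Function.extend_apply' _ _ _ hn]
      simp
  · by_cases hn : ∃ i, f i = n
    · obtain ⟨i, rfl⟩ := hn
      rw [hf.extend_apply]
      intro h0
      exact absurd h0 (b.orthonormal.ne_zero i)
    · rw [Function.extend_apply' _ _ _ hn, Function.extend_apply' _ _ _ hn]
      simp

end Diagonalization

/-! ### Compactness of operators given by a bounded weakly measurable kernel. -/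

section InnerOperator

variable {S : Type*} [MeasurableSpace S] {F : Measure S} [IsFiniteMeasure F]
  {H : Type*} [NormedAddCommGroup H] [InnerProductSpace ℝ H] {K : S → H} {C : ℝ}

lemma memLp_inner_of_bound (hK : ∀ f, Measurable fun x => (inner ℝ (K x) f : ℝ))
    (hC : ∀ x, ‖K x‖ ≤ C) (f : H) : MemLp (fun x => (inner ℝ (K x) f : ℝ)) 2 F :=
  MemLp.of_bound (hK f).aestronglyMeasurable (C * ‖f‖) (Eventually.of_forall fun x =>
    (norm_inner_le_norm _ _).trans (mul_le_mul_of_nonneg_right (hC x) (norm_nonneg _)))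

/-- The operator `f ↦ (x ↦ ⟪K x, f⟫)` into `L²(F)`, for a bounded weakly measurable `K`. -/
noncomputable def innerOperatorₗ (F : Measure S) [IsFiniteMeasure F]
    (hK : ∀ f, Measurable fun x => (inner ℝ (K x) f : ℝ)) (hC : ∀ x, ‖K x‖ ≤ C) :
    H →ₗ[ℝ] Lp ℝ 2 F where
  toFun f := (memLp_inner_of_bound (F := F) hK hC f).toLp _
  map_add' f g := by
    rw [← MemLp.toLp_add]
    congr 1
    ext x
    simp [inner_add_right]
  map_smul' c f := by
    rw [RingHom.id_apply, ← MemLp.toLp_const_smul]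
    congr 1
    ext x
    simp [inner_smul_right]

lemma norm_sq_innerOperatorₗ (hK : ∀ f, Measurable fun x => (inner ℝ (K x) f : ℝ))
    (hC : ∀ x, ‖K x‖ ≤ C) (f : H) :
    ‖innerOperatorₗ F hK hC f‖ ^ 2 = ∫ x, (inner ℝ (K x) f : ℝ) ^ 2 ∂F :=
  norm_sq_toLp (memLp_inner_of_bound hK hC f)

lemma norm_innerOperatorₗ_le (hK : ∀ f, Measurable fun x => (inner ℝ (K x) f : ℝ))
    (hC0 : 0 ≤ C) (hC : ∀ x, ‖K x‖ ≤ C) (f : H) :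
    ‖innerOperatorₗ F hK hC f‖ ≤ √(F.real Set.univ) * C * ‖f‖ := by
  refine abs_le_of_sq_le_sq' ?_ (by positivity) |>.2
  rw [norm_sq_innerOperatorₗ, mul_pow, mul_pow, Real.sq_sqrt measureReal_nonneg]
  calc ∫ x, (inner ℝ (K x) f : ℝ) ^ 2 ∂F ≤ ∫ _, (C * ‖f‖) ^ 2 ∂F := by
        refine integral_mono (memLp_inner_of_bound hK hC f).integrable_sq (integrable_const _)
          fun x => ?_
        refine sq_le_sq' ?_ ?_
        · exact neg_le_of_abs_le ((abs_real_inner_le_norm _ _).trans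
            (mul_le_mul_of_nonneg_right (hC x) (norm_nonneg _)))
        · exact (real_inner_le_norm _ _).trans
            (mul_le_mul_of_nonneg_right (hC x) (norm_nonneg _))
    _ = F.real Set.univ * C ^ 2 * ‖f‖ ^ 2 := by
        rw [integral_const, smul_eq_mul]
        ring

/-- The bounded operator `f ↦ (x ↦ ⟪K x, f⟫)` into `L²(F)`. -/
noncomputable def innerOperator (F : Measure S) [IsFiniteMeasure F]
    (hK : ∀ f, Measurable fun x => (inner ℝ (K x) f : ℝ)) (hC0 : 0 ≤ C) (hC : ∀ x, ‖K x‖ ≤ C) :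
    H →L[ℝ] Lp ℝ 2 F :=
  (innerOperatorₗ F hK hC).mkContinuous _ (norm_innerOperatorₗ_le hK hC0 hC)

lemma coeFn_innerOperator (hK : ∀ f, Measurable fun x => (inner ℝ (K x) f : ℝ)) (hC0 : 0 ≤ C)
    (hC : ∀ x, ‖K x‖ ≤ C) (f : H) :
    innerOperator F hK hC0 hC f =ᵐ[F] fun x => inner ℝ (K x) f :=
  MemLp.coeFn_toLp (memLp_inner_of_bound hK hC f)

variable {e : ℕ → H}

open IsPaddedHilbertBasis

/-- Pettis' argument: `K` is the pointwise limit of its partial expansions in `e`, whose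
coefficients are measurable. -/
lemma stronglyMeasurable_of_inner (hK : ∀ f, Measurable fun x => (inner ℝ (K x) f : ℝ))
    (he : IsPaddedHilbertBasis e) : StronglyMeasurable K := by
  refine stronglyMeasurable_of_tendsto atTop
    (f := fun n x => ∑ i ∈ Finset.range n, (inner ℝ (K x) (e i) : ℝ) • e i) (fun n => ?_) ?_
  · exact Finset.stronglyMeasurable_fun_sum _ fun i _ =>
      (hK (e i)).stronglyMeasurable.smul_const (e i)
  · refine tendsto_pi_nhds.2 fun x => ?_
    simp only [real_inner_comm (e _) (K x)]
    exact (he.hasSum (K x)).tendsto_sum_nat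

lemma stronglyMeasurable_remainder (hK : ∀ f, Measurable fun x => (inner ℝ (K x) f : ℝ))
    (he : IsPaddedHilbertBasis e) (n : ℕ) : StronglyMeasurable fun x => remainder e n (K x) := by
  refine (stronglyMeasurable_of_inner hK he).sub
    (Finset.stronglyMeasurable_fun_sum _ fun i _ => ?_)
  simp only [real_inner_comm (K _) (e i)]
  exact (hK (e i)).stronglyMeasurable.smul_const (e i)

lemma norm_sq_remainder_le {S : Type*} {K : S → H} (hC : ∀ x, ‖K x‖ ≤ C) (he : IsPaddedHilbertBasis e) (n : ℕ) (x : S) :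
    ‖‖remainder e n (K x)‖ ^ 2‖ ≤ C ^ 2 := by
  rw [Real.norm_of_nonneg (by positivity)]
  exact pow_le_pow_left₀ (norm_nonneg _) ((he.norm_remainder_le n _).trans (hC x)) 2

lemma integrable_norm_sq_remainder (hK : ∀ f, Measurable fun x => (inner ℝ (K x) f : ℝ))
    (hC : ∀ x, ‖K x‖ ≤ C) (he : IsPaddedHilbertBasis e) (n : ℕ) :
    Integrable (fun x => ‖remainder e n (K x)‖ ^ 2) F :=
  Integrable.of_bound ((stronglyMeasurable_remainder hK he n).norm.pow 2).aestronglyMeasurable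
    (C ^ 2) (Eventually.of_forall (norm_sq_remainder_le hC he n))

lemma tendsto_integral_norm_sq_remainder (hK : ∀ f, Measurable fun x => (inner ℝ (K x) f : ℝ))
    (hC : ∀ x, ‖K x‖ ≤ C) (he : IsPaddedHilbertBasis e) :
    Tendsto (fun n => ∫ x, ‖remainder e n (K x)‖ ^ 2 ∂F) atTop (𝓝 0) := by
  have h := tendsto_integral_of_dominated_convergence (μ := F)
    (F := fun n x => ‖remainder e n (K x)‖ ^ 2) (f := fun _ => 0) (fun _ => C ^ 2)
    (fun n => (integrable_norm_sq_remainder hK hC he n).aestronglyMeasurable)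
    (integrable_const _) (fun n => Eventually.of_forall (norm_sq_remainder_le hC he n))
    (Eventually.of_forall fun x => by simpa using ((he.tendsto_remainder (K x)).norm.pow 2))
  simpa using h

/-- A Hilbert–Schmidt argument: the operator norm of the error after truncation to `n` basis vectors
is at most the `L²(F)` norm of the remainder of `K x`, which tends to zero. -/
lemma isCompactOperator_innerOperator (hK : ∀ f, Measurable fun x => (inner ℝ (K x) f : ℝ))
    (hC0 : 0 ≤ C) (hC : ∀ x, ‖K x‖ ≤ C) [CompleteSpace H] [TopologicalSpace.SeparableSpace H] :
    IsCompactOperator (innerOperator F hK hC0 hC) := by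
  obtain ⟨e, he⟩ := exists_isPaddedHilbertBasis (H := H)
  set T := innerOperator F hK hC0 hC with hT
  let A : ℕ → H →L[ℝ] Lp ℝ 2 F := fun n =>
    ∑ i ∈ Finset.range n, (innerSL ℝ (e i)).smulRight (T (e i))
  have hA : ∀ n f, (T - A n) f = T (remainder e n f) := fun n f => by
    simp [A, remainder, map_sum]
  have hbound : ∀ n, ‖T - A n‖ ≤ √(∫ x, ‖remainder e n (K x)‖ ^ 2 ∂F) := fun n => by
    refine ContinuousLinearMap.opNorm_le_bound _ (Real.sqrt_nonneg _) fun f => ?_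
    refine abs_le_of_sq_le_sq' ?_ (by positivity) |>.2
    have hint := integrable_norm_sq_remainder (F := F) hK hC he n
    rw [hA, mul_pow, Real.sq_sqrt (integral_nonneg fun _ => by positivity), ← integral_mul_const]
    refine (norm_sq_innerOperatorₗ hK hC (remainder e n f)).le.trans ?_
    refine integral_mono (memLp_inner_of_bound hK hC _).integrable_sq (hint.mul_const _)
      fun x => ?_
    -- With the remainder on `K x` instead of `f`, Cauchy–Schwarz gives a bound uniform over `f` of
    -- given norm.
    simp only [← inner_remainder_comm, ← mul_pow]
    exact sq_le_sq' (neg_le_of_abs_le (abs_real_inner_le_norm _ _)) (real_inner_le_norm _ _)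
  have hlim : Tendsto A atTop (𝓝 T) := by
    rw [tendsto_iff_norm_sub_tendsto_zero]
    have h := (tendsto_integral_norm_sq_remainder (F := F) hK hC he).sqrt
    rw [Real.sqrt_zero] at h
    refine squeeze_zero (fun _ => norm_nonneg _) (fun n => ?_) h
    rw [norm_sub_rev]
    exact hbound n
  refine isCompactOperator_of_tendsto hlim (Eventually.of_forall fun n => ?_)
  induction n with
  | zero => simpa [A] using isCompactOperator_zero
  | succ n ih =>
    have h1 : IsCompactOperator ((innerSL ℝ (e n)).smulRight (T (e n))) :=
      (isCompactOperator_of_locallyCompactSpace_dom (innerSL ℝ (e n))).clm_comp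
        (ContinuousLinearMap.toSpanSingleton ℝ (T (e n)))
    have h2 : A (n + 1) = A n + (innerSL ℝ (e n)).smulRight (T (e n)) :=
      Finset.sum_range_succ _ _
    rw [h2]
    exact ih.add h1

end InnerOperator

/-! ### Existence of the Karhunen–Loève expansion. -/

section KernelExpansion

variable {S : Type*} [MeasurableSpace S] {F : Measure S} [IsProbabilityMeasure F]
  {κ : S → S → ℝ} {C : ℝ}

lemma memLp_two_mul_prod {F : Measure S} {f g : S → ℝ} (hf : MemLp f 2 F) (hg : MemLp g 2 F) :
    MemLp (fun p : S × S => f p.1 * g p.2) 2 (F.prod F) := by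
  refine (memLp_two_iff_integrable_sq
    (hf.aestronglyMeasurable.comp_fst.mul hg.aestronglyMeasurable.comp_snd)).2 ?_
  have h := hf.integrable_sq.mul_prod hg.integrable_sq
  simp only [← mul_pow] at h
  exact h

lemma memLp_kernel_section (hκ : Measurable fun p : S × S => κ p.1 p.2)
    (hb : ∀ x y, ‖κ x y‖ ≤ C) (x : S) : MemLp (κ x) 2 F :=
  MemLp.of_bound (hκ.comp measurable_prodMk_left).aestronglyMeasurable C
    (Eventually.of_forall (hb x))

/-- The section `κ x` of a bounded measurable kernel as an element of `L²(F)`. -/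
noncomputable def kernelSection (F : Measure S) [IsProbabilityMeasure F]
    (hκ : Measurable fun p : S × S => κ p.1 p.2)
    (hb : ∀ x y, ‖κ x y‖ ≤ C) (x : S) : Lp ℝ 2 F :=
  (memLp_kernel_section hκ hb x).toLp _

lemma coeFn_kernelSection (hκ : Measurable fun p : S × S => κ p.1 p.2)
    (hb : ∀ x y, ‖κ x y‖ ≤ C) (x : S) : kernelSection F hκ hb x =ᵐ[F] κ x :=
  MemLp.coeFn_toLp _

lemma inner_kernelSection (hκ : Measurable fun p : S × S => κ p.1 p.2)
    (hb : ∀ x y, ‖κ x y‖ ≤ C) (x : S) (f : Lp ℝ 2 F) :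
    inner ℝ (kernelSection F hκ hb x) f = ∫ z, κ x z * f z ∂F := by
  rw [inner_Lp_two_eq_integral]
  refine integral_congr_ae ?_
  filter_upwards [coeFn_kernelSection hκ hb x] with z hz
  rw [hz]

lemma measurable_inner_kernelSection (hκ : Measurable fun p : S × S => κ p.1 p.2)
    (hb : ∀ x y, ‖κ x y‖ ≤ C) (f : Lp ℝ 2 F) :
    Measurable fun x => (inner ℝ (kernelSection F hκ hb x) f : ℝ) := by
  simp only [inner_kernelSection]
  have h : StronglyMeasurable fun p : S × S => κ p.1 p.2 * f p.2 :=
    hκ.stronglyMeasurable.mul ((Lp.stronglyMeasurable f).comp_measurable measurable_snd)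
  exact h.integral_prod_right.measurable

lemma norm_kernelSection_le (hC0 : 0 ≤ C) (hκ : Measurable fun p : S × S => κ p.1 p.2)
    (hb : ∀ x y, ‖κ x y‖ ≤ C) (x : S) : ‖kernelSection F hκ hb x‖ ≤ C := by
  have h := Lp.norm_le_of_ae_bound (f := kernelSection F hκ hb x) hC0 (by
    filter_upwards [coeFn_kernelSection hκ hb x] with z hz
    rw [hz]
    exact hb x z)
  have h1 : measureUnivNNReal F = 1 := by simp [measureUnivNNReal]
  simpa [h1] using h

lemma integrable_mul_mul_kernel {F : Measure S} (hκ : Measurable fun p : S × S => κ p.1 p.2)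
    (hb : ∀ x y, ‖κ x y‖ ≤ C) {f g : S → ℝ} (hf : Integrable f F) (hg : Integrable g F) :
    Integrable (fun p : S × S => f p.1 * g p.2 * κ p.1 p.2) (F.prod F) :=
  (hf.mul_prod hg).mul_bdd hκ.aestronglyMeasurable (Eventually.of_forall fun p => hb p.1 p.2)

/-- A bounded, measurable, symmetric kernel whose integral operator is positive has a
Karhunen–Loève expansion. -/
theorem exists_isKarhunenLoeve [TopologicalSpace.SeparableSpace (Lp ℝ 2 F)] (hC0 : 0 ≤ C)
    (hκ : Measurable fun p : S × S => κ p.1 p.2) (hb : ∀ x y, ‖κ x y‖ ≤ C)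
    (hsymm : ∀ x y, κ x y = κ y x)
    (hpos : ∀ f : S → ℝ, Integrable f F →
      0 ≤ ∫ p : S × S, f p.1 * f p.2 * κ p.1 p.2 ∂(F.prod F)) :
    ∃ (lam : ℕ → ℝ) (v : ℕ → S → ℝ), IsKarhunenLoeve F κ lam v := by
  set K := kernelSection F hκ hb with hKdef
  have hK := measurable_inner_kernelSection (F := F) hκ hb
  have hC := norm_kernelSection_le (F := F) hC0 hκ hb
  set T := innerOperator F hK hC0 hC with hT
  have hLp : ∀ f : Lp ℝ 2 F, Integrable f F := fun f => (Lp.memLp f).integrable one_le_two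
  have hTinner : ∀ f g : Lp ℝ 2 F,
      inner ℝ (T f) g = ∫ p : S × S, g p.1 * f p.2 * κ p.1 p.2 ∂(F.prod F) := fun f g => by
    rw [integral_prod _ (integrable_mul_mul_kernel hκ hb (hLp g) (hLp f)),
      inner_Lp_two_eq_integral]
    refine integral_congr_ae ?_
    filter_upwards [coeFn_innerOperator hK hC0 hC f] with x hx
    rw [hx, inner_kernelSection, mul_comm, ← integral_const_mul]
    exact integral_congr_ae (Eventually.of_forall fun z => by ring)
  have hTsymm : (T : Lp ℝ 2 F →ₗ[ℝ] Lp ℝ 2 F).IsSymmetric := fun f g => by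
    refine (hTinner f g).trans (Eq.trans ?_ ((real_inner_comm _ _).trans (hTinner g f)).symm)
    rw [← integral_prod_swap]
    exact integral_congr_ae (Eventually.of_forall fun p => by
      simp only [Prod.fst_swap, Prod.snd_swap, hsymm p.2 p.1]
      ring)
  obtain ⟨e, lam, he, heig, hlam⟩ := exists_isPaddedHilbertBasis_eigenvectors
    (isCompactOperator_innerOperator hK hC0 hC) hTsymm
  have hnorm : ∀ j, lam j ≠ 0 → ‖e j‖ = 1 := fun j hj =>
    (he.eq_zero_or_norm j).resolve_left fun h => hj (hlam j h)
  -- Read pointwise, the eigenvalue equation says that the `j`-th coefficient of the section `κ x`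
  -- is `lam j * e j x`.
  have heig' : ∀ j, ∀ᵐ x ∂F, inner ℝ (K x) (e j) = lam j * e j x := fun j => by
    have h1 := coeFn_innerOperator (F := F) hK hC0 hC (e j)
    have h2 : (T (e j) : S → ℝ) =ᵐ[F] lam j • (e j : S → ℝ) := by
      rw [heig j]
      exact Lp.coeFn_smul _ _
    filter_upwards [h1, h2] with x hx1 hx2
    rw [← hx1, hx2, Pi.smul_apply, smul_eq_mul]
  refine ⟨lam, fun j => e j, ⟨fun j => ?_, fun j => Lp.memLp _, fun i j hi hj => ?_,
    fun j _ => ?_, ?_⟩⟩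
  · by_cases hj : lam j = 0
    · exact hj.ge
    have h1 : inner ℝ (T (e j)) (e j) = lam j := by
      rw [heig j, inner_smul_left, real_inner_self_eq_norm_sq, hnorm j hj]
      simp
    rw [← h1, hTinner]
    exact hpos _ (hLp _)
  · rw [← inner_Lp_two_eq_integral]
    split_ifs with hij
    · rw [hij, real_inner_self_eq_norm_sq, hnorm j hj, one_pow]
    · exact he.inner_eq_zero i j hij
  · filter_upwards [heig' j] with x hx
    rw [← hx, inner_kernelSection]
  · set R : ℕ → S × S → ℝ := fun n p =>
      κ p.1 p.2 - ∑ j ∈ Finset.range n, lam j * e j p.1 * e j p.2 with hR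
    have hκLp : MemLp (fun p : S × S => κ p.1 p.2) 2 (F.prod F) :=
      MemLp.of_bound hκ.aestronglyMeasurable C (Eventually.of_forall fun p => hb p.1 p.2)
    have hRLp : ∀ n, MemLp (R n) 2 (F.prod F) := fun n => by
      refine hκLp.sub (memLp_finsetSum _ fun j _ => ?_)
      simp only [mul_assoc]
      exact (memLp_two_mul_prod (Lp.memLp (e j)) (Lp.memLp (e j))).const_mul (lam j)
    -- For almost every `x`, the slice `R n (x, ·)` is the remainder of `K x` in the eigenbasis, so
    -- the norm on the product is computed fibrewise.
    have hRsq : ∀ n, ∫ p, R n p ^ 2 ∂(F.prod F)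
        = ∫ x, ‖IsPaddedHilbertBasis.remainder e n (K x)‖ ^ 2 ∂F := fun n => by
      rw [integral_prod _ (hRLp n).integrable_sq]
      refine integral_congr_ae ?_
      filter_upwards [ae_all_iff.2 heig'] with x hx
      rw [norm_sq_Lp_two_eq_integral]
      refine integral_congr_ae ?_
      have h1 : ∀ j, ∀ᵐ z ∂F, (inner ℝ (e j) (K x) • e j : Lp ℝ 2 F) z
          = lam j * e j x * e j z := fun j => by
        filter_upwards [Lp.coeFn_smul (inner ℝ (e j) (K x) : ℝ) (e j)] with z hz
        rw [hz, Pi.smul_apply, smul_eq_mul, real_inner_comm, hx j]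
      filter_upwards [coeFn_kernelSection hκ hb x, ae_all_iff.2 h1,
        Lp.coeFn_sub (K x) (∑ i ∈ Finset.range n, inner ℝ (e i) (K x) • e i),
        Lp.coeFn_fun_finsetSum (Finset.range n) fun i => (inner ℝ (e i) (K x) • e i : Lp ℝ 2 F)]
        with z hz1 hz2 hz3 hz4
      rw [IsPaddedHilbertBasis.remainder, hz3, Pi.sub_apply, hz4, hz1]
      simp only [hz2, hR]
    have hnormR : ∀ n, eLpNorm (R n) 2 (F.prod F)
        = ENNReal.ofReal (√(∫ x, ‖IsPaddedHilbertBasis.remainder e n (K x)‖ ^ 2 ∂F)) := fun n => by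
      rw [← hRsq, ← norm_sq_toLp (hRLp n), Real.sqrt_sq (norm_nonneg _), Lp.norm_toLp,
        ENNReal.ofReal_toReal (hRLp n).eLpNorm_ne_top]
    have hlim := (tendsto_integral_norm_sq_remainder (F := F) hK hC he).sqrt
    refine Tendsto.congr (fun n => (hnormR n).symm) ?_
    simpa using ENNReal.tendsto_ofReal hlim

end KernelExpansion

/-! ### The variance as a double integral and as a series. -/

section BiasVariance

variable {S : Type*} [MeasurableSpace S] {F : Measure S} [IsProbabilityMeasure F]
  {κ : S → S → ℝ} {C : ℝ}

lemma integral_centred {g : S → ℝ} (hg : Integrable g F) : ∫ x, centred F g x ∂F = 0 := by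
  simp only [centred]
  rw [integral_sub hg (integrable_const _)]
  simp

lemma integrable_centred {g : S → ℝ} (hg : Integrable g F) : Integrable (centred F g) F :=
  hg.sub (integrable_const _)

lemma memLp_two_centred {g : S → ℝ} (hg : MemLp g 2 F) : MemLp (centred F g) 2 F :=
  hg.sub (memLp_const _)

/-- Against weights of integral zero, a kernel may be replaced by its doubly centred version. -/
lemma integral_mul_centredKernel (hκ : Measurable fun p : S × S => κ p.1 p.2)
    (hb : ∀ x y, ‖κ x y‖ ≤ C) {h : S → ℝ} (hh : Integrable h F) (h0 : ∫ x, h x ∂F = 0) :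
    ∫ x, ∫ x', h x * h x' * centredKernel F κ x x' ∂F ∂F
      = ∫ p : S × S, h p.1 * h p.2 * κ p.1 p.2 ∂(F.prod F) := by
  have hint := integrable_mul_mul_kernel hκ hb hh hh
  rw [integral_prod _ hint]
  set a : S → ℝ := fun x => ∫ z, κ x z ∂F with ha
  set m : ℝ := ∫ z, ∫ z', κ z z' ∂F ∂F with hm
  have ham : Measurable a := hκ.stronglyMeasurable.integral_prod_right.measurable
  have hab : ∀ x, ‖a x‖ ≤ C := fun x => by
    have := norm_integral_le_of_norm_le_const (μ := F) (Eventually.of_forall (hb x))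
    simpa using this
  have hha : Integrable (fun x => h x * a x) F :=
    hh.mul_bdd ham.aestronglyMeasurable (Eventually.of_forall hab)
  have hinner : ∀ x, ∫ x', h x * h x' * centredKernel F κ x x' ∂F
      = (∫ x', h x * h x' * κ x x' ∂F) - h x * ∫ x', h x' * a x' ∂F := fun x => by
    have hκx : Integrable (fun x' => h x' * κ x x') F :=
      hh.mul_bdd (hκ.comp measurable_prodMk_left).aestronglyMeasurable
        (Eventually.of_forall (hb x))
    have hsub : Integrable (fun x' => h x' * κ x x' - h x' * a x') F := hκx.sub hha
    -- The terms not depending on `x'` are collected in `m - a x` and vanish on integrating `h x'`;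
    -- the remaining correction vanishes in the outer integral.
    have h1 : ∀ x', h x * h x' * centredKernel F κ x x'
        = h x * ((h x' * κ x x' - h x' * a x') + (m - a x) * h x') := fun x' => by
      simp only [centredKernel, ha, hm]
      ring
    simp only [h1, mul_assoc (h x)]
    rw [integral_const_mul, integral_const_mul, ← mul_sub,
      integral_add hsub (hh.const_mul _), integral_sub hκx hha, integral_const_mul, h0,
      mul_zero, add_zero]
  simp only [hinner]
  rw [integral_sub hint.integral_prod_left (hh.mul_const _), integral_mul_const, h0, zero_mul,
    sub_zero]

lemma biasVariance_eq (hκ : Measurable fun p : S × S => κ p.1 p.2) (hb : ∀ x y, ‖κ x y‖ ≤ C)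
    {φ : S → ℝ} (hφ : Integrable φ F) (τ : ℝ) :
    biasVariance F φ κ τ = τ ^ 2 / (∫ x, φ x ∂F) ^ 2 *
      ∫ p : S × S, centred F φ p.1 * centred F φ p.2 * κ p.1 p.2 ∂(F.prod F) := by
  rw [biasVariance, integral_mul_centredKernel hκ hb (integrable_centred hφ)
    (integral_centred hφ)]

/-- Centring one factor suffices for a covariance, so the `v j` need no centring. -/
lemma integral_centred_mul_eq_covariance {f g : S → ℝ} (hf : MemLp f 2 F) (hg : MemLp g 2 F) :
    ∫ x, centred F f x * g x ∂F = cov[f, g; F] := by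
  rw [covariance_eq_sub hf hg]
  have hfg : Integrable (fun x => f x * g x) F := hf.integrable_mul hg
  simp only [centred, sub_mul]
  rw [integral_sub hfg ((hg.integrable one_le_two).const_mul _),
    integral_const_mul]
  rfl

/-- A Karhunen–Loève expansion may be integrated termwise against `h ⊗ h`. -/
lemma IsKarhunenLoeve.hasSum_integral {lam : ℕ → ℝ} {v : ℕ → S → ℝ}
    (hv : IsKarhunenLoeve F κ lam v) (hκ : MemLp (fun p : S × S => κ p.1 p.2) 2 (F.prod F))
    {h : S → ℝ} (hh : MemLp h 2 F) :
    HasSum (fun j => lam j * (∫ x, h x * v j x ∂F) ^ 2)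
      (∫ p : S × S, h p.1 * h p.2 * κ p.1 p.2 ∂(F.prod F)) := by
  refine (hasSum_iff_tendsto_nat_of_nonneg
    (fun j => mul_nonneg (hv.nonneg j) (sq_nonneg _)) _).2 ?_
  have hhh := memLp_two_mul_prod hh hh
  have hterm : ∀ j, MemLp (fun p : S × S => lam j * v j p.1 * v j p.2) 2 (F.prod F) := fun j => by
    simp only [mul_assoc]
    exact (memLp_two_mul_prod (hv.memLp j) (hv.memLp j)).const_mul (lam j)
  have hR : ∀ n, MemLp (fun p : S × S =>
      κ p.1 p.2 - ∑ j ∈ Finset.range n, lam j * v j p.1 * v j p.2) 2 (F.prod F) := fun n =>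
    hκ.sub (memLp_finsetSum _ fun j _ => hterm j)
  have hlim : Tendsto (fun n => (hR n).toLp _) atTop (𝓝 0) := by
    rw [tendsto_zero_iff_norm_tendsto_zero]
    simp only [Lp.norm_toLp]
    simpa [Function.comp_def] using (ENNReal.tendsto_toReal ENNReal.zero_ne_top).comp hv.expansion
  -- Only continuity of the pairing with `h ⊗ h` is used; orthonormality and the eigenvalue equation
  -- play no role.
  have hinner := (tendsto_const_nhds (x := hhh.toLp _)).inner (𝕜 := ℝ) hlim
  rw [inner_zero_right] at hinner
  have hval : ∀ n, inner ℝ (hhh.toLp _) ((hR n).toLp _)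
      = (∫ p : S × S, h p.1 * h p.2 * κ p.1 p.2 ∂(F.prod F))
        - ∑ j ∈ Finset.range n, lam j * (∫ x, h x * v j x ∂F) ^ 2 := fun n => by
    rw [inner_toLp_toLp]
    simp only [mul_sub, Finset.mul_sum]
    have hi : ∀ j, Integrable
        (fun p : S × S => h p.1 * h p.2 * (lam j * v j p.1 * v j p.2)) (F.prod F) := fun j =>
      hhh.integrable_mul (hterm j)
    have hiκ : Integrable (fun p : S × S => h p.1 * h p.2 * κ p.1 p.2) (F.prod F) :=
      hhh.integrable_mul hκ
    rw [integral_sub hiκ (integrable_finsetSum _ fun j _ => hi j),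
      integral_finsetSum _ fun j _ => hi j]
    congr 1
    refine Finset.sum_congr rfl fun j _ => ?_
    rw [sq_integral_eq_integral_prod, ← integral_const_mul]
    exact integral_congr_ae (Eventually.of_forall fun p => by ring)
  simp only [hval] at hinner
  have := (tendsto_const_nhds
    (x := ∫ p : S × S, h p.1 * h p.2 * κ p.1 p.2 ∂(F.prod F))).sub hinner
  simpa using this

end BiasVariance

/-! ### The law of the selection bias under the Gaussian process prior. -/

theorem proposition5 {d : ℕ}
    (F : Measure (EuclideanSpace ℝ (Fin d))) [IsProbabilityMeasure F]
    (φ : EuclideanSpace ℝ (Fin d) → ℝ) (hφ : Measurable φ)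
    (hφ01 : ∀ x, φ x ∈ Set.Icc (0 : ℝ) 1) (hφpos : 0 < ∫ x, φ x ∂F)
    -- the sampling model with missing outcomes
    {W : Type*} [MeasurableSpace W] (Q : Measure W) [IsProbabilityMeasure Q] (σ2 : ℝ≥0)
    (X : W → EuclideanSpace ℝ (Fin d)) (ε : W → ℝ) (A : W → Bool)
    (hmodel : IsMissingDataModel Q F φ σ2 X ε A)
    -- the prior
    {Ω : Type*} [MeasurableSpace Ω] (P : Measure Ω) [IsProbabilityMeasure P]
    (τ : ℝ) (hτ : 0 < τ)
    (ρ : EuclideanSpace ℝ (Fin d) → EuclideanSpace ℝ (Fin d) → ℝ)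
    (hρ : IsCorrelationFunction ρ)
    (β : EuclideanSpace ℝ (Fin d) → Ω → ℝ)
    (hβmeas : Measurable (fun p : EuclideanSpace ℝ (Fin d) × Ω => β p.1 p.2))
    (hβ : IsGP β (fun _ => 0) (fun x x' => τ ^ 2 * ρ x x') P) :
    0 ≤ biasVariance F φ ρ τ ∧
    HasLaw (fun ω => selectionBias Q X ε A (fun x => β x ω))
      (gaussianReal 0 (biasVariance F φ ρ τ).toNNReal) P ∧
    (∃ (lam : ℕ → ℝ) (v : ℕ → EuclideanSpace ℝ (Fin d) → ℝ), IsKarhunenLoeve F ρ lam v) ∧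
    ∀ (lam : ℕ → ℝ) (v : ℕ → EuclideanSpace ℝ (Fin d) → ℝ), IsKarhunenLoeve F ρ lam v →
      Summable (fun j => lam j * cov[φ, v j; F] ^ 2) ∧
      biasVariance F φ ρ τ =
        τ ^ 2 / (∫ x, φ x ∂F) ^ 2 * ∑' j, lam j * cov[φ, v j; F] ^ 2 := by
  have hτ2 : 0 < τ ^ 2 := by positivity
  have hvar : ∀ x, τ ^ 2 * ρ x x ≤ τ ^ 2 := fun x => by rw [hρ.diag, mul_one]
  have hρm : Measurable fun p : EuclideanSpace ℝ (Fin d) × EuclideanSpace ℝ (Fin d) =>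
      ρ p.1 p.2 := by
    have h := (hβ.measurable_kernel hβmeas).const_mul (τ ^ 2)⁻¹
    simpa only [inv_mul_cancel_left₀ hτ2.ne'] using h
  -- Since `τ ^ 2 * ρ x y` is `E (β x * β y)`, its absolute value is at most the average of two
  -- variances, both `τ ^ 2`.
  have hρb : ∀ x y, ‖ρ x y‖ ≤ 1 := fun x y => by
    have h1 := (norm_integral_le_integral_norm (μ := P) fun ω => β x ω * β y ω).trans
      (integral_norm_mul_le (hβ.memLp_two x) (hβ.memLp_two y))
    have h2 := hβ.integral_mul x x
    have h3 := hβ.integral_mul y y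
    simp only [← sq, hρ.diag, mul_one] at h2 h3
    rw [hβ.integral_mul, h2, h3, norm_mul, Real.norm_of_nonneg hτ2.le] at h1
    nlinarith
  have hφLp : MemLp φ 2 F := MemLp.of_bound hφ.aestronglyMeasurable 1
    (Eventually.of_forall fun x => by
      rw [Real.norm_of_nonneg (hφ01 x).1]
      exact (hφ01 x).2)
  have hφi : Integrable φ F := hφLp.integrable one_le_two
  have hci := integrable_centred hφi
  have hpos : ∀ f : EuclideanSpace ℝ (Fin d) → ℝ, Integrable f F →
      0 ≤ ∫ p : EuclideanSpace ℝ (Fin d) × EuclideanSpace ℝ (Fin d),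
        f p.1 * f p.2 * ρ p.1 p.2 ∂(F.prod F) := fun f hf => by
    have h1 := hβ.integral_sq_integral hβmeas hvar hf
    simp only [mul_left_comm _ (τ ^ 2), integral_const_mul] at h1
    exact nonneg_of_mul_nonneg_right (h1 ▸ integral_nonneg fun _ => sq_nonneg _) hτ2
  have hc := biasVariance_eq hρm hρb hφi τ
  -- Needed for instance search to find separability of `L²(F)`.
  have : Fact ((2 : ℝ≥0∞) ≠ ∞) := ⟨ENNReal.ofNat_ne_top⟩
  have : TopologicalSpace.SeparableSpace (Lp ℝ 2 F) := inferInstance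
  refine ⟨?_, ?_, exists_isKarhunenLoeve zero_le_one hρm hρb hρ.symm hpos, fun lam v hv => ?_⟩
  · rw [hc]
    exact mul_nonneg (by positivity) (hpos _ hci)
  · have hlaw := hβ.hasLaw_integral hβmeas hvar (hci.const_mul (∫ x, φ x ∂F)⁻¹)
    have hcv : ∫ p : EuclideanSpace ℝ (Fin d) × EuclideanSpace ℝ (Fin d),
        ((∫ x, φ x ∂F)⁻¹ * centred F φ p.1) * ((∫ x, φ x ∂F)⁻¹ * centred F φ p.2) *
          (τ ^ 2 * ρ p.1 p.2) ∂(F.prod F) = biasVariance F φ ρ τ := by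
      rw [hc, ← integral_const_mul]
      exact integral_congr_ae (Eventually.of_forall fun p => by
        simp only
        field_simp)
    rw [hcv] at hlaw
    refine hlaw.congr ?_
    -- Weight and test variable are both `1`: the process is integrable on the product, hence almost
    -- every path is `F`-integrable.
    have hint := hβ.integrable_mul_mul hβmeas hvar (integrable_const (μ := F) (1 : ℝ))
      (memLp_const (1 : ℝ))
    filter_upwards [hint.prod_left_ae] with ω hω
    simp only [one_mul, mul_one] at hω
    have hβω : Measurable fun x => β x ω := hβmeas.comp measurable_prodMk_right
    rw [hmodel.selectionBias_eq hφ hφ01 hφpos hβω hω,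
      ← integral_const_mul]
    simp only [mul_assoc]
  · have hρLp : MemLp (fun p : EuclideanSpace ℝ (Fin d) × EuclideanSpace ℝ (Fin d) =>
        ρ p.1 p.2) 2 (F.prod F) :=
      MemLp.of_bound hρm.aestronglyMeasurable 1 (Eventually.of_forall fun p => hρb p.1 p.2)
    have hsum := hv.hasSum_integral hρLp (memLp_two_centred hφLp)
    simp only [integral_centred_mul_eq_covariance hφLp (hv.memLp _)] at hsum
    exact ⟨hsum.summable, by rw [hc, hsum.tsum_eq]⟩
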